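/- Let $G$ be a finite connected plane (embedded planar) graph, loops and parallel edges allowed, with at least one edge, with non-negative (possibly infinite) edge weights and a set $X\subseteq V(G)$ of terminals, and let $G^*$ be its dual: every face of $G$ is a vertex of $G^*$, every vertex $v$ of $G$ corresponds to a face $v^*$ of $G^*$, and every edge $e$ of $G$ corresponds to an edge $e^*$ of $G^*$ with the same weight. A cycle of $G^*$ is a simple cycle, its length is the total weight of its edges, and $int(C^*)$ and $ext(C^*)$ denote the subgraphs of $G^*$ formed by the boundaries of the faces that are enclosed, respectively not enclosed, by the cycle $C^*$ (with respect to a fixed infinite face of $G^*$). For two faces $v_e^*$ and $v^*$ of $G^*$, a cycle is called $v_e^*$-$v^*$ separating if it encloses exactly one of $v_e^*$ and $v^*$. A cycle is called terminal-separating (is said to separate terminals) if it encloses a face $x^*$ with $x\in X$ and does not enclose a face $y^*$ with $y\in X$. A cycle crosses $C^*$ if it is contained neither in $int(C^*)$ nor in $ext(C^*)$. Let $v_e^*$ and $v^*$ be faces of $G^*$, and suppose that $G^*$ has at least one cycle that is both $v_e^*$-$v^*$ separating and terminal-separating. Let $C^*$ be a shortest $v_e^*$-$v^*$ separating cycle,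 and suppose that $C^*$ does not separate terminals. Then, among the cycles of $G^*$ that are both $v_e^*$-$v^*$ separating and terminal-separating, there is a shortest one that does not cross $C^*$. -/

import Mathlib

open scoped ENNReal

/-- The darts of a graph with edge set `E`: two oppositely directed darts per edge. -/
abbrev Dart (E : Type*) : Type _ := E × ℤˣ

/-- The edge underlying a dart. -/
def Dart.edge {E : Type*} (d : Dart E) : E := d.1

/-- The reversal of darts. -/
def Dart.rev {E : Type*} : Equiv.Perm (Dart E) where
  toFun d := (d.1, -d.2)
  invFun d := (d.1, -d.2)
  left_inv d := by simp
  right_inv d := by simp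

/-- A graph (loops and parallel edges allowed) embedded in an oriented closed surface, given by its
rotation system: `rot` maps every dart to the next dart, in clockwise order, with the same tail. -/
structure EmbeddedGraph (E : Type*) where
  /-- the rotation at the vertices -/
  rot : Equiv.Perm (Dart E)

namespace EmbeddedGraph

variable {E : Type*}

/-- The vertices are the cycles of the rotation. -/
def Vertex (G : EmbeddedGraph E) : Type _ := Quotient (Equiv.Perm.SameCycle.setoid G.rot)

/-- The tail of a dart. -/
def tail (G : EmbeddedGraph E) (d : Dart E) : G.Vertex :=
  Quotient.mk (Equiv.Perm.SameCycle.setoid G.rot) d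

/-- The head of a dart. -/
def head (G : EmbeddedGraph E) (d : Dart E) : G.Vertex := G.tail (Dart.rev d)

/-- The dual embedded graph `G*`, on the same edge set. Its rotation sends a dart `d` to the dart
that follows `d` on the boundary walk of the face to the left of `d`; as a dart of `G*`, `d` points
from the face on its left to the face on its right. (These rotations are the clockwise ones of `G*`
on the surface with the opposite orientation, so that `G**` is exactly `G`.) -/
def dual (G : EmbeddedGraph E) : EmbeddedGraph E where
  rot := G.rot * Dart.rev

/-- The faces of `G` are the vertices of `G*`. -/
def Face (G : EmbeddedGraph E) : Type _ := G.dual.Vertex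

/-- The face to the left of a dart. -/
def leftFace (G : EmbeddedGraph E) (d : Dart E) : G.Face := G.dual.tail d

/-- The face to the right of a dart. -/
def rightFace (G : EmbeddedGraph E) (d : Dart E) : G.Face := G.dual.head d

theorem dual_dual (G : EmbeddedGraph E) : G.dual.dual = G := by
  cases G with
  | mk r =>
    simp only [dual, mk.injEq]
    ext d <;> simp [Dart.rev]

/-- The face `v*` of `G*` that corresponds to the vertex `v` of `G`; it is formed by the same
darts. -/
def vertexFace (G : EmbeddedGraph E) : G.Vertex → G.dual.Face :=
  Quotient.map id (by
    intro a b h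
    have e : G.dual.dual.rot = G.rot := by rw [dual_dual]
    change Equiv.Perm.SameCycle G.dual.dual.rot a b
    rw [e]
    exact h)

/-- `G` is connected. -/
def Connected (G : EmbeddedGraph E) : Prop :=
  ∀ u v : G.Vertex,
    Relation.ReflTransGen (fun a b => ∃ d : Dart E, G.tail d = a ∧ G.head d = b) u v

/-- A connected embedded graph is plane if its surface is the sphere, that is, if it satisfies
Euler's formula `|V| - |E| + |F| = 2`. -/
def IsConnectedPlane (G : EmbeddedGraph E) : Prop :=
  G.Connected ∧ Nat.card G.Vertex + Nat.card G.Face = Nat.card E + 2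

/-- `C` is the edge set of a simple cycle: a closed walk with darts `d 0, …, d n` (indices modulo
`n + 1`) that repeats no vertex and no edge. A loop is a cycle, and so are two parallel edges. -/
def IsCycle (G : EmbeddedGraph E) (C : Finset E) : Prop :=
  ∃ (n : ℕ) (d : Fin (n + 1) → Dart E),
    (∀ i, G.head (d i) = G.tail (d (i + 1))) ∧
    Function.Injective (fun i => G.tail (d i)) ∧
    Function.Injective (fun i => (d i).edge) ∧
    (C : Set E) = Set.range (fun i => (d i).edge)

/-- The face `f` is enclosed by `C`, where `o` is the infinite face: one cannot get from `f`
to `o` by passing from face to face across edges that are not in `C`. -/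
def Encloses (G : EmbeddedGraph E) (o : G.Face) (C : Finset E) (f : G.Face) : Prop :=
  ¬ Relation.ReflTransGen
    (fun a b => ∃ d : Dart E, d.edge ∉ C ∧ G.leftFace d = a ∧ G.rightFace d = b) f o

/-- `C` separates the faces `f` and `g`: exactly one of them is enclosed by `C`. -/
def FaceSeparating (G : EmbeddedGraph E) (o f g : G.Face) (C : Finset E) : Prop :=
  Xor (G.Encloses o C f) (G.Encloses o C g)

/-- `C` separates the faces in `X`: one of them is enclosed by `C` and another one is not. -/
def SetSeparating (G : EmbeddedGraph E) (o : G.Face) (X : Set G.Face) (C : Finset E) : Prop :=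
  (∃ x ∈ X, G.Encloses o C x) ∧ ∃ y ∈ X, ¬ G.Encloses o C y

/-- The edges of `int(C)`, the subgraph formed by the boundaries of the faces enclosed by `C`. -/
def interior (G : EmbeddedGraph E) (o : G.Face) (C : Finset E) : Set E :=
  {e | ∃ d : Dart E, d.edge = e ∧ G.Encloses o C (G.leftFace d)}

/-- The edges of `ext(C)`, the subgraph formed by the boundaries of the faces not enclosed
by `C`. -/
def exterior (G : EmbeddedGraph E) (o : G.Face) (C : Finset E) : Set E :=
  {e | ∃ d : Dart E, d.edge = e ∧ ¬ G.Encloses o C (G.leftFace d)}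

/-- The cycle `C'` crosses the cycle `C`: it is neither contained in `int(C)` nor in `ext(C)`. -/
def Crosses (G : EmbeddedGraph E) (o : G.Face) (C' C : Finset E) : Prop :=
  ¬ (C' : Set E) ⊆ G.interior o C ∧ ¬ (C' : Set E) ⊆ G.exterior o C

/-- `C` is a shortest cycle among the cycles with property `P`, for the edge lengths `w`. -/
def IsShortestCycle (G : EmbeddedGraph E) (w : E → ℝ≥0∞) (P : Finset E → Prop)
    (C : Finset E) : Prop :=
  G.IsCycle C ∧ P C ∧ ∀ C' : Finset E, G.IsCycle C' → P C' → ∑ e ∈ C, w e ≤ ∑ e ∈ C', w e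

end EmbeddedGraph

/-! In a connected plane graph the simple cycles are exactly the edge cuts of the bonds of its face
graph, a bond being a nonempty face set that is connected and has nonempty connected complement
(`IsCycle.exists_isFaceBond`, `IsFaceBond.exists_isCycle`). Enclosing, separating and not crossing
become statements about membership in bonds, so the theorem reduces to one about cuts in an
arbitrary connected multigraph (`exists_isBond_not_crossing`).

There, let `A` be a shortest bond separating `s` from `t`, and `B` a bond that separates `s` from
`t` and also splits `X`. After passing to complements and swapping `s` and `t`, one has `s ∈ A ∩ B`,
`t ∉ A ∪ B` and `X ⊆ Aᶜ`. `exists_isBond_uncrossing` builds a bond `Q ⊆ Aᶜ` that contains `t`,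
splits `X`, and whose cut uses only edges of the cuts of `A` and `B`. Such a `Q` is no heavier than
`B`: the symmetric difference of `A`, `B` and `Q` still separates `s` from `t`, so its cut weighs at
least as much as that of `A`, while its weight and that of `Q` add up to at most the weights of `A`
and `B`. -/

section Cuts

/-! ### Connected sets and bonds in a multigraph. -/

variable {V E : Type*} (p q : E → V)

/-- The edges with exactly one end in `S`, in the multigraph in which `e` joins `p e` and `q e`. -/
def edgeCut (S : Set V) : Set E := {e | ¬ (p e ∈ S ↔ q e ∈ S)}

/-- `S` induces a connected subgraph: no edge cut splits it. -/
def CutConnected (S : Set V) : Prop :=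
  ∀ U ⊆ S, U.Nonempty → edgeCut p q U ⊆ edgeCut p q S → U = S

/-- `S` and its complement are nonempty and connected. -/
structure IsBond (S : Set V) : Prop where
  nonempty : S.Nonempty
  compl_nonempty : Sᶜ.Nonempty
  connected : CutConnected p q S
  compl_connected : CutConnected p q Sᶜ

/-- The vertices that cannot be separated from `v` by a cut contained in `T`. -/
def cutComponent (T : Set E) (v : V) : Set V := {x | ∀ U : Set V, v ∈ U → edgeCut p q U ⊆ T → x ∈ U}

/-- The total weight of the edges of a cut. -/
noncomputable def cutWeight [Fintype E] (w : E → ℝ≥0∞) (S : Set V) : ℝ≥0∞ :=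
  ∑ e, (edgeCut p q S).indicator w e

variable {p q}

theorem mem_edgeCut {S : Set V} {e : E} : e ∈ edgeCut p q S ↔ ¬ (p e ∈ S ↔ q e ∈ S) := Iff.rfl

theorem edgeCut_compl (S : Set V) : edgeCut p q Sᶜ = edgeCut p q S := by
  ext e; simp only [mem_edgeCut, Set.mem_compl_iff]; tauto

theorem edgeCut_inter_subset (S U : Set V) :
    edgeCut p q (S ∩ U) ⊆ edgeCut p q S ∪ edgeCut p q U := by
  intro e; simp only [mem_edgeCut, Set.mem_inter_iff, Set.mem_union]; tauto

theorem edgeCut_union_subset (S U : Set V) :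
    edgeCut p q (S ∪ U) ⊆ edgeCut p q S ∪ edgeCut p q U := by
  intro e; simp only [mem_edgeCut, Set.mem_union]; tauto

theorem IsBond.compl {S : Set V} (h : IsBond p q S) : IsBond p q Sᶜ :=
  ⟨h.compl_nonempty, by simpa using h.nonempty, h.compl_connected, by simpa using h.connected⟩

theorem CutConnected.subset_compl_or_subset {S U : Set V} (h : CutConnected p q S)
    (hU : ∀ e ∈ edgeCut p q U, ¬ (p e ∈ S ∧ q e ∈ S)) : S ⊆ Uᶜ ∨ S ⊆ U := by
  rcases (S ∩ U).eq_empty_or_nonempty with h0 | h0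
  · exact Or.inl (Set.subset_compl_iff_disjoint_right.2 (Set.disjoint_iff_inter_eq_empty.2 h0))
  · right
    rw [← Set.inter_eq_left]
    refine h _ Set.inter_subset_left h0 fun e he => ?_
    have := hU e
    simp only [mem_edgeCut, Set.mem_inter_iff] at *
    tauto

theorem CutConnected.subset_compl_or_subset_of_subset {S U : Set V} (h : CutConnected p q S)
    (hU : edgeCut p q U ⊆ edgeCut p q S) : S ⊆ Uᶜ ∨ S ⊆ U :=
  h.subset_compl_or_subset fun _ he hS => hU he ⟨fun _ => hS.2, fun _ => hS.1⟩

theorem IsBond.eq_or_eq_compl {S U : Set V} (h : IsBond p q S)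
    (hU : edgeCut p q U ⊆ edgeCut p q S) : U = ∅ ∨ U = Set.univ ∨ U = S ∨ U = Sᶜ := by
  have h1 := h.connected.subset_compl_or_subset_of_subset hU
  have h2 := h.compl_connected.subset_compl_or_subset_of_subset (U := U) (by rwa [edgeCut_compl])
  simp only [Set.ext_iff, Set.subset_def, Set.mem_compl_iff,
    Set.mem_empty_iff_false, Set.mem_univ] at *
  rcases h1 with h1 | h1 <;> rcases h2 with h2 | h2
  · left; intro x; have := h1 x; have := h2 x; tauto
  · right; right; right; intro x; have := h1 x; have := h2 x; tauto
  · right; right; left; intro x; have := h1 x; have := h2 x; tauto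
  · right; left; intro x; have := h1 x; have := h2 x; tauto

theorem mem_cutComponent_self (T : Set E) (v : V) : v ∈ cutComponent p q T v := fun _ h _ => h

theorem cutComponent_subset {T : Set E} {v : V} {U : Set V} (hv : v ∈ U) (hU : edgeCut p q U ⊆ T) :
    cutComponent p q T v ⊆ U := fun _ h => h U hv hU

theorem edgeCut_cutComponent_subset (T : Set E) (v : V) :
    edgeCut p q (cutComponent p q T v) ⊆ T := by
  intro e he
  by_contra heT
  refine he ⟨fun h U hv hU => ?_, fun h U hv hU => ?_⟩ <;>
  · have h1 := h U hv hU
    by_contra h2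
    exact heT (hU (by rw [mem_edgeCut]; tauto))

theorem cutConnected_cutComponent (T : Set E) (v : V) :
    CutConnected p q (cutComponent p q T v) := by
  intro U hU ⟨x, hx⟩ hcut
  have hT := edgeCut_cutComponent_subset (p := p) (q := q) T v
  by_cases hv : v ∈ U
  · exact hU.antisymm (cutComponent_subset hv (hcut.trans hT))
  -- If `U` misses `v`, the component minus `U` is a competitor in the definition of the component,
  -- so it contains the whole component, including `x ∈ U`.
  · have := hU hx (cutComponent p q T v ∩ Uᶜ) ⟨mem_cutComponent_self _ _, hv⟩
      ((edgeCut_inter_subset _ _).trans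
        (Set.union_subset hT (by rw [edgeCut_compl]; exact hcut.trans hT)))
    exact absurd hx this.2

theorem CutConnected.union {S U : Set V} (hS : CutConnected p q S) (hU : CutConnected p q U)
    {e : E} (he : (p e ∈ S ∧ q e ∈ U) ∨ (p e ∈ U ∧ q e ∈ S)) : CutConnected p q (S ∪ U) := by
  intro R hR hR0 hcut
  have key : ∀ P : Set V, P ⊆ S ∪ U → CutConnected p q P → P ⊆ Rᶜ ∨ P ⊆ R := fun P hP hc =>
    hc.subset_compl_or_subset fun e he hPe => hcut he ⟨fun _ => hP hPe.2, fun _ => hP hPe.1⟩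
  obtain ⟨x, hx⟩ := hR0
  have h3 : p e ∈ R ↔ q e ∈ R := by
    by_contra h
    refine hcut h ⟨fun _ => ?_, fun _ => ?_⟩ <;> rcases he with he | he
    exacts [Or.inr he.2, Or.inl he.2, Or.inl he.1, Or.inr he.1]
  rcases key S Set.subset_union_left hS with h1 | h1 <;>
    rcases key U Set.subset_union_right hU with h2 | h2
  · exact ((hR hx).elim (fun h => h1 h hx) fun h => h2 h hx).elim
  · rcases he with he | he
    exacts [absurd (h3.2 (h2 he.2)) (h1 he.1), absurd (h3.1 (h2 he.1)) (h1 he.2)]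
  · rcases he with he | he
    exacts [absurd (h3.1 (h1 he.1)) (h2 he.2), absurd (h3.2 (h1 he.2)) (h2 he.1)]
  · exact hR.antisymm (Set.union_subset h1 h2)

/-- A splitting of `Qᶜ` leaves the connected set `A` on one side, so the other side is a part away
from `A` whose cut lies in that of `Q`. It therefore suffices to exclude such parts. -/
theorem CutConnected.compl_of_forall {A Q : Set V} (hA : CutConnected p q A) (hQA : Q ⊆ Aᶜ)
    (h : ∀ U : Set V, U ⊆ Qᶜ → U ⊆ Aᶜ → edgeCut p q U ⊆ edgeCut p q Q → U = ∅) :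
    CutConnected p q Qᶜ := by
  intro U hU hU0 hcut
  rw [edgeCut_compl] at hcut
  rcases hA.subset_compl_or_subset (U := U) (fun e he hAe => hcut he
    ⟨fun hq => absurd hAe.1 (hQA hq), fun hq => absurd hAe.2 (hQA hq)⟩) with h1 | h1
  · exact absurd (h U hU (Set.subset_compl_comm.1 h1) hcut) hU0.ne_empty
  · have h2 := h (Qᶜ ∩ Uᶜ) Set.inter_subset_left
      (Set.inter_subset_right.trans (Set.compl_subset_compl.2 h1))
      ((edgeCut_inter_subset _ _).trans
        (by simp only [edgeCut_compl]; exact Set.union_subset le_rfl hcut))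
    refine hU.antisymm fun x hx => ?_
    by_contra hxU
    exact (h2 ▸ (⟨hx, hxU⟩ : x ∈ Qᶜ ∩ Uᶜ) : x ∈ (∅ : Set V))

/-- Take the component `A` of `s` inside `S`, then the component `R` of `t` inside `Aᶜ`. A part of
`Rᶜ` away from `A` could be joined only to `R`, but every edge leaving `R` ends in `A`. -/
theorem exists_isBond_edgeCut_subset (hconn : CutConnected p q Set.univ) {S : Set V} {s t : V}
    (hs : s ∈ S) (ht : t ∉ S) :
    ∃ R : Set V, IsBond p q R ∧ s ∉ R ∧ t ∈ R ∧ edgeCut p q R ⊆ edgeCut p q S := by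
  have hA := cutConnected_cutComponent (p := p) (q := q) (edgeCut p q S) s
  have hAS : cutComponent p q (edgeCut p q S) s ⊆ S := cutComponent_subset hs le_rfl
  have hsA : s ∈ cutComponent p q (edgeCut p q S) s := mem_cutComponent_self _ _
  have hAcut := edgeCut_cutComponent_subset (p := p) (q := q) (edgeCut p q S) s
  generalize cutComponent p q (edgeCut p q S) s = A at *
  have hR := cutConnected_cutComponent (p := p) (q := q) (edgeCut p q A) t
  have hRA : cutComponent p q (edgeCut p q A) t ⊆ Aᶜ :=
    cutComponent_subset (fun h => ht (hAS h)) (edgeCut_compl _).subset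
  have hcR : edgeCut p q (cutComponent p q (edgeCut p q A) t) ⊆ edgeCut p q A :=
    edgeCut_cutComponent_subset _ _
  have htR : t ∈ cutComponent p q (edgeCut p q A) t := mem_cutComponent_self _ _
  generalize cutComponent p q (edgeCut p q A) t = R at *
  have hsR : s ∉ R := fun h => hRA h hsA
  refine ⟨R, ⟨⟨t, htR⟩, ⟨s, hsR⟩, hR, ?_⟩, hsR, htR, hcR.trans hAcut⟩
  refine hA.compl_of_forall hRA fun U hUR hUA hcut => ?_
  by_contra hU0
  have := hconn U (Set.subset_univ _) (Set.nonempty_iff_ne_empty.2 hU0) fun e he => by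
    have h1 := hcut he
    have h2 := hcR h1
    rcases not_iff.1 he with h
    by_cases hp : p e ∈ U
    · have hq : q e ∈ R := by
        by_contra hq
        exact h1 ⟨fun h => absurd h (hUR hp), fun h => absurd h hq⟩
      exact (h2 ⟨fun h => absurd h (hUA hp), fun h => absurd h (hRA hq)⟩).elim
    · have hq : q e ∈ U := h.1 hp
      have hp : p e ∈ R := by
        by_contra hp
        exact h1 ⟨fun h => absurd h hp, fun h => absurd h (hUR hq)⟩
      exact (h2 ⟨fun h => absurd h (hRA hp), fun h => absurd h (hUA hq)⟩).elim
  exact hUR (this ▸ Set.mem_univ t) htR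

/-! ### Uncrossing two bonds. -/

/-- The regions into which the cut of `B` divides `Aᶜ` can be joined to a bond that contains `t`
and separates `X`. -/
theorem exists_isBond_uncrossing {A B X : Set V} {s t x y : V} (hA : IsBond p q A)
    (hB : IsBond p q B) (hsA : s ∈ A) (htA : t ∉ A) (hsB : s ∈ B) (htB : t ∉ B)
    (hXA : X ⊆ Aᶜ) (hx : x ∈ X) (hxB : x ∈ B) (hy : y ∈ X) (hyB : y ∉ B) :
    ∃ Q : Set V, IsBond p q Q ∧ t ∈ Q ∧ Q ⊆ Aᶜ ∧ (∃ x ∈ X, x ∈ Q) ∧ (∃ y ∈ X, y ∉ Q) ∧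
      edgeCut p q Q ⊆ edgeCut p q A ∪ edgeCut p q B := by
  by_cases hAB : A ⊆ B
  · refine ⟨Bᶜ, hB.compl, htB, Set.compl_subset_compl.2 hAB, ⟨y, hy, hyB⟩,
      ⟨x, hx, by simpa using hxB⟩, ?_⟩
    rw [edgeCut_compl]
    exact Set.subset_union_right
  set T := edgeCut p q A ∪ edgeCut p q B with hT
  -- Complements are connected for free: a part `U` of `Qᶜ` away from `A` has all its cut edges
  -- inside `Aᶜ`, hence in the cut of `B`. Each of `B` and `Bᶜ` thus lies inside `U` or outside it,
  -- and neither lies inside, as `s ∈ A ∩ B` and `A ⊄ B`.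
  have hconn : ∀ Q : Set V, Q ⊆ Aᶜ → edgeCut p q Q ⊆ T → CutConnected p q Qᶜ := by
    intro Q hQA hQT
    refine hA.connected.compl_of_forall hQA fun U hUQ hUA hcut => ?_
    have key : edgeCut p q U ⊆ edgeCut p q B := by
      intro e he
      refine (hQT (hcut he)).resolve_left fun h => ?_
      have h1 := hcut he
      have h5 := @hUQ (p e)
      have h6 := @hUQ (q e)
      have h7 := @hUA (p e)
      have h8 := @hUA (q e)
      have h9 := @hQA (p e)
      have h10 := @hQA (q e)
      simp only [mem_edgeCut, Set.mem_compl_iff] at *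
      clear hcut hQT
      grind
    have h1 : B ⊆ Uᶜ :=
      (hB.connected.subset_compl_or_subset_of_subset key).resolve_right fun h => hUA (h hsB) hsA
    have h2 : Bᶜ ⊆ Uᶜ :=
      (hB.compl_connected.subset_compl_or_subset_of_subset (by rwa [edgeCut_compl])).resolve_right
        fun h => hAB (Set.compl_subset_compl.1 (h.trans hUA))
    rw [← Set.compl_univ_iff, Set.eq_univ_iff_forall]
    exact fun z => (em (z ∈ B)).elim (fun h => h1 h) fun h => h2 h
  have hbond : ∀ Q : Set V, t ∈ Q → Q ⊆ Aᶜ → CutConnected p q Q → edgeCut p q Q ⊆ T →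
      IsBond p q Q := fun Q htQ hQA hQ hQT =>
    ⟨⟨t, htQ⟩, ⟨s, fun h => hQA h hsA⟩, hQ,
      hconn Q hQA hQT⟩
  -- The region of `x`: it contains `x` but not `y`, and lies in `B \ A`. Only `t` may be missing.
  set R := cutComponent p q T x with hR
  have hxR : x ∈ R := mem_cutComponent_self _ _
  have hRT : edgeCut p q R ⊆ T := edgeCut_cutComponent_subset _ _
  have hRB : R ⊆ B := cutComponent_subset hxB Set.subset_union_right
  have hRA : R ⊆ Aᶜ := cutComponent_subset (hXA hx) (by
    rw [edgeCut_compl]; exact Set.subset_union_left)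
  have hyR : y ∉ R := fun h => hyB (hRB h)
  by_cases htR : t ∈ R
  · exact ⟨R, hbond R htR hRA (cutConnected_cutComponent _ _) hRT, htR, hRA,
      ⟨x, hx, hxR⟩, ⟨y, hy, hyR⟩, hRT⟩
  -- The component of `t` in `Aᶜ \ R`. If it meets `X` it splits `X`, since it misses `x`; otherwise
  -- `Q ∪ R` contains `x` but not `y`.
  set Q := cutComponent p q (edgeCut p q A ∪ edgeCut p q R) t with hQ
  have htQ : t ∈ Q := mem_cutComponent_self _ _
  have hQcut : edgeCut p q Q ⊆ edgeCut p q A ∪ edgeCut p q R := edgeCut_cutComponent_subset _ _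
  have hQT : edgeCut p q Q ⊆ T :=
    hQcut.trans (Set.union_subset Set.subset_union_left hRT)
  have hQA : Q ⊆ Aᶜ := cutComponent_subset htA (by
    rw [edgeCut_compl]; exact Set.subset_union_left)
  have hQR : Q ⊆ Rᶜ := cutComponent_subset htR (by
    rw [edgeCut_compl]; exact Set.subset_union_right)
  by_cases hXQ : ∃ z ∈ X, z ∈ Q
  · exact ⟨Q, hbond Q htQ hQA (cutConnected_cutComponent _ _) hQT, htQ, hQA,
      hXQ, ⟨x, hx, fun h => hQR h hxR⟩, hQT⟩
  have hQRA : Q ∪ R ⊆ Aᶜ := Set.union_subset hQA hRA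
  have hQRT : edgeCut p q (Q ∪ R) ⊆ T :=
    (edgeCut_union_subset _ _).trans (Set.union_subset hQT hRT)
  -- `Q` is joined to `R` by an edge: otherwise connectedness of `Aᶜ` would force `Q = Aᶜ`, which
  -- contains `x`.
  obtain ⟨e, he, heA⟩ : ∃ e ∈ edgeCut p q Q, e ∉ edgeCut p q A := by
    by_contra! h
    have := hA.compl_connected Q hQA ⟨t, htQ⟩ (by rw [edgeCut_compl]; exact h)
    exact hQR (this ▸ hXA hx) hxR
  have hQRc : CutConnected p q (Q ∪ R) := by
    refine CutConnected.union (S := Q) (U := R) (cutConnected_cutComponent _ _)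
      (cutConnected_cutComponent _ _) (e := e) ?_
    have h1 := (hQcut he).resolve_left heA
    have h2 := @hQR (p e)
    have h3 := @hQR (q e)
    rw [mem_edgeCut] at he h1
    clear_value Q R
    clear hQcut heA hQR hQRT hQRA hXQ
    rw [Set.mem_compl_iff] at h2 h3
    tauto
  exact ⟨Q ∪ R, hbond _ (Or.inl htQ) hQRA hQRc hQRT, Or.inl htQ, hQRA,
    ⟨x, hx, Or.inr hxR⟩, ⟨y, hy, fun h => h.elim (fun h => hXQ ⟨y, hy, h⟩) hyR⟩, hQRT⟩

theorem cutWeight_compl [Fintype E] (w : E → ℝ≥0∞) (S : Set V) :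
    cutWeight p q w Sᶜ = cutWeight p q w S := by
  simp only [cutWeight, edgeCut_compl]

theorem cutWeight_mono [Fintype E] (w : E → ℝ≥0∞) {S U : Set V}
    (h : edgeCut p q S ⊆ edgeCut p q U) : cutWeight p q w S ≤ cutWeight p q w U :=
  Finset.sum_le_sum fun _ _ => Set.indicator_le_indicator_of_subset h (fun _ => zero_le) _

/-- The nested equivalence describes the symmetric difference of `Q`, `A` and `B`, whose cut is the
sum mod 2 of the three cuts. The inequality holds edge by edge: an edge in exactly one of the cuts
of `A` and `B` counts once on the left. -/
theorem cutWeight_add_cutWeight_le [Fintype E] (w : E → ℝ≥0∞) {A B Q : Set V}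
    (h : edgeCut p q Q ⊆ edgeCut p q A ∪ edgeCut p q B) :
    cutWeight p q w {v | v ∈ Q ↔ (v ∈ A ↔ v ∈ B)} + cutWeight p q w Q ≤
      cutWeight p q w A + cutWeight p q w B := by
  classical
  simp only [cutWeight, ← Finset.sum_add_distrib]
  refine Finset.sum_le_sum fun e _ => ?_
  have := @h e
  simp only [Set.indicator_apply, mem_edgeCut, Set.mem_union, Set.mem_ofPred_eq] at *
  by_cases h1 : p e ∈ A <;> by_cases h2 : q e ∈ A <;> by_cases h3 : p e ∈ B <;>
    by_cases h4 : q e ∈ B <;> by_cases h5 : p e ∈ Q <;> by_cases h6 : q e ∈ Q <;>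
    simp_all

/-- If `A` is a shortest bond separating `s` and `t`, it does not separate `X`, and `B` separates
both `s`, `t` and `X`, then some bond that is no longer than `B` does the same without
crossing `A`. -/
theorem exists_isBond_not_crossing_of_mem [Fintype E] (hconn : CutConnected p q Set.univ)
    (w : E → ℝ≥0∞) {A B X : Set V} {s t : V} (hA : IsBond p q A) (hB : IsBond p q B)
    (hmin : ∀ S, IsBond p q S → ¬ (s ∈ S ↔ t ∈ S) → cutWeight p q w A ≤ cutWeight p q w S)
    (hsA : s ∈ A) (htA : t ∉ A) (hsB : s ∈ B) (htB : t ∉ B)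
    (hXA : X ⊆ Aᶜ) (hX : ∃ x ∈ X, x ∈ B) (hX' : ∃ y ∈ X, y ∉ B) :
    ∃ Q : Set V, IsBond p q Q ∧ ¬ (s ∈ Q ↔ t ∈ Q) ∧ Q ⊆ Aᶜ ∧ (∃ x ∈ X, x ∈ Q) ∧
      (∃ y ∈ X, y ∉ Q) ∧ cutWeight p q w Q ≤ cutWeight p q w B := by
  obtain ⟨x, hx, hxB⟩ := hX
  obtain ⟨y, hy, hyB⟩ := hX'
  obtain ⟨Q, hQ, htQ, hQA, h1, h2, hcut⟩ :=
    exists_isBond_uncrossing hA hB hsA htA hsB htB hXA hx hxB hy hyB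
  have hsQ : s ∉ Q := fun h => hQA h hsA
  refine ⟨Q, hQ, by tauto, hQA, h1, h2, ?_⟩
  -- The final cancellation needs a finite weight of `A`; if it is infinite, so is that of `B`.
  by_cases htop : cutWeight p q w A = ⊤
  · have := hmin B hB (by tauto)
    rw [htop, top_le_iff] at this
    rw [this]
    exact le_top
  obtain ⟨R, hR, hsR, htR, hRcut⟩ := exists_isBond_edgeCut_subset hconn
    (S := {v | v ∈ Q ↔ (v ∈ A ↔ v ∈ B)}ᶜ) (s := s) (t := t) (by simp; tauto) (by simp; tauto)
  rw [edgeCut_compl] at hRcut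
  have h3 := (hmin R hR (by tauto)).trans (cutWeight_mono w hRcut)
  have h4 := cutWeight_add_cutWeight_le w hcut
  exact (ENNReal.add_le_add_iff_left htop).1 ((add_le_add_left h3 _).trans h4)

theorem exists_isBond_not_crossing [Fintype E] (hconn : CutConnected p q Set.univ)
    (w : E → ℝ≥0∞) {A B X : Set V} {s t : V} (hA : IsBond p q A) (hB : IsBond p q B)
    (hmin : ∀ S, IsBond p q S → ¬ (s ∈ S ↔ t ∈ S) → cutWeight p q w A ≤ cutWeight p q w S)
    (hstA : ¬ (s ∈ A ↔ t ∈ A)) (hstB : ¬ (s ∈ B ↔ t ∈ B))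
    (hXA : ¬ ((∃ x ∈ X, x ∈ A) ∧ ∃ y ∈ X, y ∉ A)) (hXB : (∃ x ∈ X, x ∈ B) ∧ ∃ y ∈ X, y ∉ B) :
    ∃ Q : Set V, IsBond p q Q ∧ ¬ (s ∈ Q ↔ t ∈ Q) ∧ (Q ⊆ Aᶜ ∨ Q ⊆ A) ∧ (∃ x ∈ X, x ∈ Q) ∧
      (∃ y ∈ X, y ∉ Q) ∧ cutWeight p q w Q ≤ cutWeight p q w B := by
  -- Complementing `A` or `B` and swapping `s` with `t` preserve cuts, weights and the conclusion.
  wlog hX : X ⊆ Aᶜ generalizing A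
  · obtain ⟨z, hz, hzA⟩ := Set.not_subset.1 hX
    have hXA' : X ⊆ A := fun u hu => by
      by_contra huA
      exact hXA ⟨⟨z, hz, not_not.1 hzA⟩, u, hu, huA⟩
    obtain ⟨Q, h1, h2, h3, h4⟩ := this hA.compl (by simpa only [cutWeight_compl] using hmin)
      (by simp only [Set.mem_compl_iff]; tauto)
      (fun ⟨⟨u, hu, huA⟩, _⟩ => huA (hXA' hu)) (by rwa [compl_compl])
    rw [compl_compl] at h3
    exact ⟨Q, h1, h2, h3.symm, h4⟩
  wlog hs : s ∈ A generalizing s t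
  · obtain ⟨Q, h1, h2, h3⟩ := this (s := t) (t := s) (by tauto)
      (fun S hS h => hmin S hS (by tauto)) (by tauto) (by tauto)
    exact ⟨Q, h1, by tauto, h3⟩
  wlog hsB : s ∈ B generalizing B
  · obtain ⟨Q, h⟩ := this hB.compl (by simp only [Set.mem_compl_iff]; tauto)
      (by simp only [Set.mem_compl_iff]; tauto) hsB
    rw [cutWeight_compl] at h
    exact ⟨Q, h⟩
  obtain ⟨Q, h1, h2, h3, h4⟩ := exists_isBond_not_crossing_of_mem hconn w hA hB hmin hs
    (by tauto) hsB (by tauto) hX hXB.1 hXB.2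
  exact ⟨Q, h1, h2, Or.inl h3, h4⟩

end Cuts

/-! ### Darts, faces and duality. -/

namespace EmbeddedGraph

variable {E : Type*}

instance [Finite E] (H : EmbeddedGraph E) : Finite H.Vertex :=
  inferInstanceAs (Finite (Quotient _))

instance [Finite E] (H : EmbeddedGraph E) : Finite H.Face :=
  inferInstanceAs (Finite H.dual.Vertex)

end EmbeddedGraph

namespace Dart

variable {E : Type*}

theorem rev_rev (d : Dart E) : Dart.rev (Dart.rev d) = d := by
  simp [Dart.rev]

theorem edge_rev (d : Dart E) : (Dart.rev d).edge = d.edge := rfl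

theorem rev_ne (d : Dart E) : Dart.rev d ≠ d := by
  intro h
  have := congrArg Prod.snd h
  simp only [Dart.rev, Equiv.coe_fn_mk] at this
  rcases Int.units_eq_one_or d.2 with h | h <;> rw [h] at this <;> exact absurd this (by decide)

theorem eq_or_eq_rev_of_edge_eq {d d' : Dart E} (h : d.edge = d'.edge) :
    d = d' ∨ d = Dart.rev d' := by
  rcases d with ⟨e, s⟩
  rcases d' with ⟨e', s'⟩
  obtain rfl : e = e' := h
  rcases Int.units_eq_one_or s with rfl | rfl <;> rcases Int.units_eq_one_or s' with rfl | rfl <;>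
    simp [Dart.rev]

theorem eq_pos_or_eq_neg (d : Dart E) : d = (d.edge, 1) ∨ d = Dart.rev (d.edge, 1) :=
  eq_or_eq_rev_of_edge_eq rfl

end Dart

namespace EmbeddedGraph

variable {E : Type*}

theorem head_rev (H : EmbeddedGraph E) (d : Dart E) : H.head (Dart.rev d) = H.tail d := by
  simp only [head, Dart.rev_rev]

theorem tail_rev (H : EmbeddedGraph E) (d : Dart E) : H.tail (Dart.rev d) = H.head d := rfl

theorem leftFace_rev (H : EmbeddedGraph E) (d : Dart E) :
    H.leftFace (Dart.rev d) = H.rightFace d := rfl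

theorem rightFace_rev (H : EmbeddedGraph E) (d : Dart E) :
    H.rightFace (Dart.rev d) = H.leftFace d := H.dual.head_rev d

theorem tail_rot (H : EmbeddedGraph E) (d : Dart E) : H.tail (H.rot d) = H.tail d :=
  Quotient.sound ⟨-1, by simp⟩

theorem leftFace_rot (H : EmbeddedGraph E) (d : Dart E) :
    H.leftFace (H.rot d) = H.rightFace d := by
  have h := H.dual.tail_rot (Dart.rev d)
  have h' : H.dual.rot (Dart.rev d) = H.rot d := by
    simp only [dual, Equiv.Perm.mul_apply, Dart.rev_rev]
  rw [h'] at h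
  exact h

/-! ### Connectedness -/

theorem connected_iff {H : EmbeddedGraph E} :
    H.Connected ↔ ∀ U : Set H.Vertex, (∀ d, H.tail d ∈ U ↔ H.head d ∈ U) →
      U.Nonempty → U = Set.univ := by
  constructor
  · rintro h U hU ⟨u, hu⟩
    refine Set.eq_univ_of_forall fun v => ?_
    induction h u v with
    | refl => exact hu
    | tail _ h ih =>
      obtain ⟨d, rfl, rfl⟩ := h
      exact (hU d).1 ih
  · intro h u v
    have := h {v | Relation.ReflTransGen
      (fun a b => ∃ d : Dart E, H.tail d = a ∧ H.head d = b) u v}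
      (fun d => ⟨fun hd => hd.tail ⟨d, rfl, rfl⟩, fun hd => hd.tail ⟨Dart.rev d, rfl, H.head_rev d⟩⟩)
      ⟨u, .refl⟩
    exact (this ▸ Set.mem_univ v :)

/-- Rotating about a vertex crosses edges one at a time, so a face set closed under crossing edges
contains all or none of the faces around a vertex. Connectedness of the vertices then spreads it
everywhere. -/
theorem Connected.dual {H : EmbeddedGraph E} (hH : H.Connected) : H.dual.Connected := by
  rw [connected_iff] at hH ⊢
  intro U hU ⟨f, hf⟩
  have hrot : ∀ d, H.leftFace (H.rot d) ∈ U ↔ H.leftFace d ∈ U := fun d => by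
    rw [leftFace_rot]
    exact (hU d).symm
  have hpow : ∀ (n : ℤ) d, H.leftFace ((H.rot ^ n) d) ∈ U ↔ H.leftFace d ∈ U := by
    intro n
    induction n with
    | zero => simp
    | succ n ih => intro d; rw [zpow_add_one, Equiv.Perm.mul_apply, ih, hrot]
    | pred n ih =>
      intro d
      rw [zpow_sub_one, Equiv.Perm.mul_apply, ih, ← hrot]
      simp
  have htail : ∀ d d', H.tail d = H.tail d' → (H.leftFace d ∈ U ↔ H.leftFace d' ∈ U) := by
    intro d d' h
    obtain ⟨n, rfl⟩ := Quotient.exact h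
    exact (hpow n d).symm
  obtain ⟨d, rfl⟩ := Quotient.exists_rep f
  have := hH {v | ∃ d, H.tail d = v ∧ H.leftFace d ∈ U} (fun d => ?_) ⟨_, d, rfl, hf⟩
  · refine Set.eq_univ_of_forall fun g => ?_
    obtain ⟨d, rfl⟩ := Quotient.exists_rep g
    obtain ⟨d', h, h'⟩ := (this ▸ Set.mem_univ (H.tail d) :)
    exact (htail _ _ h).1 h'
  · constructor
    · rintro ⟨d', h, h'⟩
      exact ⟨Dart.rev d, rfl, (hU d).1 ((htail _ _ h).1 h')⟩
    · rintro ⟨d', h, h'⟩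
      exact ⟨d, rfl, (hU d).2 ((htail _ _ h).1 h')⟩

theorem IsConnectedPlane.dual {H : EmbeddedGraph E} (hH : H.IsConnectedPlane) :
    H.dual.IsConnectedPlane := by
  refine ⟨hH.1.dual, ?_⟩
  have h : Nat.card H.dual.Face = Nat.card H.Vertex := by
    change Nat.card H.dual.dual.Vertex = _
    rw [dual_dual]
  rw [h, add_comm]
  exact hH.2

/-! ### Cuts of the face graph are the elements of the cycle space -/

section Incidence

variable [Fintype E]

open Classical in
/-- The incidence matrix over `ZMod 2`; loops give zero rows. -/
noncomputable def incidence (H : EmbeddedGraph E) : Matrix E H.Vertex (ZMod 2) :=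
  fun e v => (if H.tail (e, 1) = v then 1 else 0) + if H.head (e, 1) = v then 1 else 0

open Classical in
/-- The sum of `z` over the darts with tail `v`. -/
noncomputable def dartSum (H : EmbeddedGraph E) (z : Dart E → ZMod 2) (v : H.Vertex) : ZMod 2 :=
  ∑ d : Dart E, if H.tail d = v then z d else 0

noncomputable instance (H : EmbeddedGraph E) : Fintype H.Vertex := Fintype.ofFinite _

theorem incidence_mulVec (H : EmbeddedGraph E) (f : H.Vertex → ZMod 2) (e : E) :
    H.incidence.mulVec f e = f (H.tail (e, 1)) + f (H.head (e, 1)) := by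
  classical
  simp [incidence, Matrix.mulVec, dotProduct, add_mul, Finset.sum_add_distrib]

theorem transpose_incidence_mulVec (H : EmbeddedGraph E) (z : E → ZMod 2) (v : H.Vertex) :
    H.incidence.transpose.mulVec z v = H.dartSum (fun d => z d.edge) v := by
  classical
  have h : (Finset.univ : Finset ℤˣ) = {1, -1} := rfl
  simp only [Matrix.mulVec, dotProduct, Matrix.transpose_apply, incidence, dartSum,
    Fintype.sum_prod_type, h]
  refine Finset.sum_congr rfl fun e _ => ?_
  rw [Finset.sum_pair (by decide)]
  change _ = (if H.tail (e, 1) = v then z e else 0) + if H.head (e, 1) = v then z e else 0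
  simp only [add_mul, ite_mul, one_mul, zero_mul]

theorem dartSum_rot (H : EmbeddedGraph E) (z : Dart E → ZMod 2) (v : H.Vertex) :
    H.dartSum (fun d => z (H.rot d)) v = H.dartSum z v := by
  classical
  unfold dartSum
  rw [← Equiv.sum_comp H.rot fun d => if H.tail d = v then z d else 0]
  simp only [tail_rot]

theorem dartSum_add (H : EmbeddedGraph E) (z z' : Dart E → ZMod 2) (v : H.Vertex) :
    H.dartSum (fun d => z d + z' d) v = H.dartSum z v + H.dartSum z' v := by
  classical
  simp only [dartSum, ← Finset.sum_add_distrib]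
  refine Finset.sum_congr rfl fun d _ => ?_
  split_ifs <;> simp

/-- The edge of `d` separates the faces left of `d` and of `H.rot d`; summed around a vertex, every
face value occurs twice. -/
theorem dartSum_dual_incidence (H : EmbeddedGraph E) (g : H.dual.Vertex → ZMod 2) (v : H.Vertex) :
    H.dartSum (fun d => H.dual.incidence.mulVec g d.edge) v = 0 := by
  have h : (fun d : Dart E => H.dual.incidence.mulVec g d.edge) =
      fun d => g (H.dual.tail d) + g (H.dual.tail (H.rot d)) := by
    funext d
    rw [incidence_mulVec, show H.dual.tail (H.rot d) = H.dual.head d from H.leftFace_rot d]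
    rcases d.eq_pos_or_eq_neg with h | h <;> rw [h]
    · rfl
    · rw [tail_rev, head_rev, add_comm, Dart.edge_rev]
      rfl
  rw [h, dartSum_add, H.dartSum_rot fun d => g (H.dual.tail d)]
  exact CharTwo.add_self_eq_zero _

theorem finrank_ker_incidence_le (H : EmbeddedGraph E) (hH : H.Connected) :
    Module.finrank (ZMod 2) (LinearMap.ker H.incidence.mulVecLin) ≤ 1 := by
  rw [connected_iff] at hH
  refine finrank_le_one (⟨fun _ => 1, ?_⟩ : LinearMap.ker H.incidence.mulVecLin) ?_
  · rw [LinearMap.mem_ker]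
    funext e
    rw [Matrix.mulVecLin_apply, incidence_mulVec]
    exact CharTwo.add_self_eq_zero _
  · rintro ⟨f, hf⟩
    rw [LinearMap.mem_ker] at hf
    have hf' : ∀ d, f (H.tail d) = f (H.head d) := by
      intro d
      have h := congrFun hf d.edge
      rw [Matrix.mulVecLin_apply, incidence_mulVec] at h
      have h := CharTwo.add_eq_zero.1 h
      rcases d.eq_pos_or_eq_neg with h' | h' <;> rw [h']
      · exact h
      · rw [tail_rev, head_rev]
        exact h.symm
    by_cases hV : Nonempty H.Vertex
    · obtain ⟨u⟩ := hV
      have := hH {v | f v = f u} (fun d => by simp [hf']) ⟨u, rfl⟩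
      refine ⟨f u, Subtype.ext (funext fun v => ?_)⟩
      have hv : f v = f u := (this ▸ Set.mem_univ v :)
      simp [hv]
    · exact ⟨0, Subtype.ext (funext fun v => (hV ⟨v⟩).elim)⟩

theorem card_le_rank_incidence (H : EmbeddedGraph E) (hH : H.Connected) :
    Nat.card H.Vertex ≤ H.incidence.rank + 1 := by
  have h := LinearMap.finrank_range_add_finrank_ker H.incidence.mulVecLin
  have h' := H.finrank_ker_incidence_le hH
  rw [Module.finrank_fintype_fun_eq_card, ← Nat.card_eq_fintype_card] at h
  rw [Matrix.rank]
  omega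

/-- In a connected plane graph, every even edge set is the boundary of a set of faces. -/
theorem IsConnectedPlane.exists_mulVec_eq {H : EmbeddedGraph E} (hH : H.IsConnectedPlane)
    {z : E → ZMod 2} (hz : ∀ v, H.dartSum (fun d => z d.edge) v = 0) :
    ∃ g : H.dual.Vertex → ZMod 2, H.dual.incidence.mulVec g = z := by
  have hle : LinearMap.range H.dual.incidence.mulVecLin ≤
      LinearMap.ker H.incidence.transpose.mulVecLin := by
    rintro _ ⟨g, rfl⟩
    rw [LinearMap.mem_ker]
    funext v
    rw [Matrix.mulVecLin_apply, transpose_incidence_mulVec]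
    exact H.dartSum_dual_incidence g v
  have h1 := H.card_le_rank_incidence hH.1
  have h2 := H.dual.card_le_rank_incidence hH.1.dual
  have h3 := LinearMap.finrank_range_add_finrank_ker H.incidence.transpose.mulVecLin
  rw [Module.finrank_fintype_fun_eq_card, ← Nat.card_eq_fintype_card] at h3
  have h4 := H.incidence.rank_transpose
  rw [Matrix.rank] at h4
  have h5 := hH.2
  rw [Matrix.rank] at h2
  change Nat.card H.Face ≤ _ at h2
  -- By Euler's formula the kernel has dimension at most `|E| - (|V| - 1) = |F| - 1`, which is at
  -- most the rank of the dual incidence matrix.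
  have heq := Submodule.eq_of_le_of_finrank_le hle (by omega)
  have hz' : z ∈ LinearMap.range H.dual.incidence.mulVecLin := by
    rw [heq, LinearMap.mem_ker]
    funext v
    rw [Matrix.mulVecLin_apply, transpose_incidence_mulVec]
    exact hz v
  exact hz'

end Incidence

end EmbeddedGraph

/-! ### Minimal cuts are bonds. -/

section Cuts

variable {V E : Type*} {p q : E → V}

theorem CutConnected.edgeCut_nonempty (hconn : CutConnected p q Set.univ) {S : Set V}
    (hS : S.Nonempty) (hS' : Sᶜ.Nonempty) : (edgeCut p q S).Nonempty := by
  by_contra h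
  rw [Set.not_nonempty_iff_eq_empty] at h
  have := hconn S (Set.subset_univ _) hS (by rw [h]; exact Set.empty_subset _)
  rw [this, Set.compl_univ] at hS'
  exact Set.not_nonempty_empty hS'

theorem edgeCut_iff_subset {S U : Set V} :
    edgeCut p q {x | x ∈ U ↔ x ∈ S} ⊆ symmDiff (edgeCut p q U) (edgeCut p q S) := by
  intro e he
  simp only [mem_edgeCut, Set.mem_symmDiff, Set.mem_ofPred_eq] at *
  tauto

theorem isBond_of_minimal (hconn : CutConnected p q Set.univ) {S : Set V}
    (hS : (edgeCut p q S).Nonempty)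
    (hmin : ∀ U : Set V, (edgeCut p q U).Nonempty → edgeCut p q U ⊆ edgeCut p q S →
      edgeCut p q U = edgeCut p q S) : IsBond p q S := by
  have hne : ∀ S : Set V, (edgeCut p q S).Nonempty → S.Nonempty := by
    rintro S ⟨e, he⟩
    by_contra h
    rw [Set.not_nonempty_iff_eq_empty] at h
    simp [mem_edgeCut, h] at he
  have key : ∀ S : Set V, (edgeCut p q S).Nonempty →
      (∀ U : Set V, (edgeCut p q U).Nonempty → edgeCut p q U ⊆ edgeCut p q S →
        edgeCut p q U = edgeCut p q S) → CutConnected p q S := by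
    intro S hS hmin U hU hU0 hcut
    have hcU : (edgeCut p q U).Nonempty := by
      refine hconn.edgeCut_nonempty hU0 ?_
      exact (hne Sᶜ (by rwa [edgeCut_compl])).mono (Set.compl_subset_compl.2 hU)
    -- By minimality `U` and `S` have equal cuts, so the set where they agree has empty cut and is
    -- everything.
    have h := edgeCut_iff_subset (p := p) (q := q) (S := S) (U := U)
    rw [hmin U hcU hcut, symmDiff_self] at h
    obtain ⟨u, hu⟩ := hU0
    have h1 := hconn _ (Set.subset_univ _) ⟨u, by simp [hu, hU hu]⟩
      (h.trans (Set.empty_subset _))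
    ext x
    exact (h1 ▸ Set.mem_univ x :)
  exact ⟨hne S hS, hne Sᶜ (by rwa [edgeCut_compl]), key S hS hmin,
    key Sᶜ (by rwa [edgeCut_compl]) (by simpa only [edgeCut_compl] using hmin)⟩

end Cuts

/-! ### Cycles as bonds of faces. -/

namespace EmbeddedGraph

variable {E : Type*}

/-- The edges between a set of faces and its complement. -/
abbrev faceCut (H : EmbeddedGraph E) (S : Set H.Face) : Set E :=
  edgeCut (fun e => H.leftFace (e, 1)) (fun e => H.rightFace (e, 1)) S

/-- A set of faces that is connected and has connected complement. -/
abbrev IsFaceBond (H : EmbeddedGraph E) (S : Set H.Face) : Prop :=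
  IsBond (fun e => H.leftFace (e, 1)) (fun e => H.rightFace (e, 1)) S

theorem edge_mem_faceCut {H : EmbeddedGraph E} {S : Set H.Face} {d : Dart E} :
    d.edge ∈ H.faceCut S ↔ ¬ (H.leftFace d ∈ S ↔ H.rightFace d ∈ S) := by
  rcases d.eq_pos_or_eq_neg with h | h <;> rw [h]
  · rfl
  · rw [leftFace_rev, rightFace_rev, Dart.edge_rev, mem_edgeCut, Dart.edge]
    tauto

theorem Connected.cutConnected_univ {H : EmbeddedGraph E} (hH : H.Connected) :
    CutConnected (fun e => H.leftFace (e, 1)) (fun e => H.rightFace (e, 1)) Set.univ := by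
  intro U _ hU0 hcut
  refine connected_iff.1 hH.dual U (fun d => ?_) hU0
  by_contra h
  exact hcut (edge_mem_faceCut.2 h) (by simp)

theorem encloses_iff {H : EmbeddedGraph E} {S : Set H.Face}
    (hS : H.IsFaceBond S) {C : Finset E} (hC : (C : Set E) = H.faceCut S) (o f : H.Face) :
    H.Encloses o C f ↔ ¬ (f ∈ S ↔ o ∈ S) := by
  rw [Encloses, not_iff_not]
  have hmem : ∀ d : Dart E, d.edge ∉ C ↔ (H.leftFace d ∈ S ↔ H.rightFace d ∈ S) := fun d => by
    rw [← Finset.mem_coe, hC, edge_mem_faceCut, not_not]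
  constructor
  · intro h
    induction h with
    | refl => rfl
    | tail _ h ih =>
      obtain ⟨d, hd, rfl, rfl⟩ := h
      exact ih.trans ((hmem d).1 hd)
  · intro h
    -- The set reachable from `f` has its cut inside that of the bond, so it is `S`, `Sᶜ` or
    -- everything.
    set U : Set H.Face := {g | Relation.ReflTransGen
      (fun a b => ∃ d : Dart E, d.edge ∉ C ∧ H.leftFace d = a ∧ H.rightFace d = b) f g} with hU
    have hfU : f ∈ U := .refl
    have hcut : H.faceCut U ⊆ H.faceCut S := by
      intro e he
      by_contra h
      have heC : e ∉ C := by rwa [← Finset.mem_coe, hC]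
      exact he ⟨fun h => h.tail ⟨(e, 1), heC, rfl, rfl⟩,
        fun h => h.tail ⟨Dart.rev (e, 1), heC, rfl, H.rightFace_rev _⟩⟩
    change o ∈ U
    rcases hS.eq_or_eq_compl hcut with h1 | h1 | h1 | h1
    · exact absurd hfU (by simp [h1])
    · exact h1 ▸ Set.mem_univ o
    · rw [h1] at hfU ⊢
      exact h.1 hfU
    · rw [h1] at hfU ⊢
      exact fun ho => hfU (h.2 ho)

section Even

variable [Fintype E]

/-- Every vertex has an even number of darts with edge in `Z`. -/
def IsEven (H : EmbeddedGraph E) (Z : Set E) : Prop :=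
  ∀ v, H.dartSum (fun d => Z.indicator 1 d.edge) v = 0

theorem isEven_faceCut (H : EmbeddedGraph E) (S : Set H.Face) : H.IsEven (H.faceCut S) := by
  classical
  intro v
  let g : H.dual.Vertex → ZMod 2 := fun f => if f ∈ (S : Set H.dual.Vertex) then 1 else 0
  rw [← H.dartSum_dual_incidence g v]
  congr 1
  funext d
  rw [incidence_mulVec]
  change _ = (if H.leftFace (d.edge, 1) ∈ S then 1 else 0) +
    if H.rightFace (d.edge, 1) ∈ S then 1 else 0
  by_cases h1 : H.leftFace (d.edge, 1) ∈ S <;> by_cases h2 : H.rightFace (d.edge, 1) ∈ S <;>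
    simp [mem_edgeCut, h1, h2, CharTwo.add_self_eq_zero]

theorem IsEven.exists_faceCut_eq {H : EmbeddedGraph E} (hH : H.IsConnectedPlane) {Z : Set E}
    (hZ : H.IsEven Z) : ∃ S : Set H.Face, H.faceCut S = Z := by
  classical
  obtain ⟨g, hg⟩ := hH.exists_mulVec_eq hZ
  have h01 : ∀ a : ZMod 2, a = 0 ∨ a = 1 := by decide
  refine ⟨{f | g f = 1}, Set.ext fun e => ?_⟩
  have h := congrFun hg e
  rw [incidence_mulVec] at h
  change ¬ (g (H.dual.tail (e, 1)) = 1 ↔ g (H.dual.head (e, 1)) = 1) ↔ _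
  by_cases he : e ∈ Z <;>
    rcases h01 (g (H.dual.tail (e, 1))) with h1 | h1 <;>
    rcases h01 (g (H.dual.head (e, 1))) with h2 | h2 <;>
    simp_all [CharTwo.add_self_eq_zero]

theorem IsEven.exists_dart_ne {H : EmbeddedGraph E} {Z : Set E} (hZ : H.IsEven Z) {x : Dart E}
    (hx : x.edge ∈ Z) : ∃ y : Dart E, y ≠ x ∧ H.tail y = H.tail x ∧ y.edge ∈ Z := by
  classical
  by_contra! h
  have h1 := hZ (H.tail x)
  rw [dartSum, Fintype.sum_eq_single x fun y hy => ?_] at h1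
  · simp [hx] at h1
  · split_ifs with hv
    · exact Set.indicator_of_notMem (h y hy hv) _
    · rfl

/-- Evenness lets a walk in `Z` continue without backtracking forever; a shortest closed stretch of
it is a cycle. -/
theorem IsEven.exists_isCycle_subset {H : EmbeddedGraph E} {Z : Set E} (hZ : H.IsEven Z)
    (hZ0 : Z.Nonempty) : ∃ C : Finset E, H.IsCycle C ∧ (C : Set E) ⊆ Z := by
  classical
  have hnext : ∀ x : {x : Dart E // x.edge ∈ Z}, ∃ y : {x : Dart E // x.edge ∈ Z},
      y.1 ≠ Dart.rev x.1 ∧ H.tail y.1 = H.head x.1 := by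
    rintro ⟨x, hx⟩
    obtain ⟨y, h1, h2, h3⟩ := hZ.exists_dart_ne (x := Dart.rev x) hx
    exact ⟨⟨y, h3⟩, h1, h2⟩
  choose f hf hf' using hnext
  obtain ⟨e, he⟩ := hZ0
  let a : ℕ → {x : Dart E // x.edge ∈ Z} := fun i => f^[i] ⟨(e, 1), he⟩
  have ha : ∀ i, a (i + 1) = f (a i) := fun i => Function.iterate_succ_apply' f i _
  have hP : ∃ n, ∃ i, H.tail (a i).1 = H.tail (a (i + (n + 1))).1 := by
    obtain ⟨i, j, hij, h⟩ := Finite.exists_ne_map_eq_of_infinite fun i => H.tail (a i).1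
    rcases lt_or_gt_of_ne hij with hij | hij
    · obtain ⟨n, rfl⟩ := Nat.exists_eq_add_of_lt hij
      exact ⟨n, i, h⟩
    · obtain ⟨n, rfl⟩ := Nat.exists_eq_add_of_lt hij
      exact ⟨n, j, h.symm⟩
  obtain ⟨n, ⟨i, hi⟩, hmin⟩ : ∃ n, (∃ i, H.tail (a i).1 = H.tail (a (i + (n + 1))).1) ∧
      ∀ m < n, ¬ ∃ i, H.tail (a i).1 = H.tail (a (i + (m + 1))).1 :=
    ⟨Nat.find hP, Nat.find_spec hP, fun m hm => Nat.find_min hP hm⟩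
  let d : Fin (n + 1) → Dart E := fun k => (a (i + k)).1
  have hd : ∀ k, H.head (d k) = H.tail (d (k + 1)) := by
    intro k
    have h : H.head (d k) = H.tail (a (i + (k + 1))).1 := by
      rw [← add_assoc, ha, hf']
    rw [h]
    rcases (Fin.le_last k).eq_or_lt with rfl | hk
    · rw [Fin.last_add_one]
      exact hi.symm
    · simp only [d, Fin.val_add_one_of_lt hk]
  have hinj : ∀ k l : Fin (n + 1), k < l → H.tail (d k) ≠ H.tail (d l) := by
    intro k l hkl h
    have hkl' : (k : ℕ) < l := hkl
    refine hmin (l - k - 1) (by omega) ⟨i + k, ?_⟩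
    rw [show i + (k : ℕ) + (l - k - 1 + 1) = i + l by omega]
    exact h
  have hinj' : Function.Injective fun k => H.tail (d k) := by
    intro k l h
    by_contra hkl
    rcases lt_or_gt_of_ne hkl with hkl | hkl
    exacts [hinj k l hkl h, hinj l k hkl h.symm]
  have hedge : ∀ k l : Fin (n + 1), k < l → (d k).edge ≠ (d l).edge := by
    intro k l hkl h
    rcases Dart.eq_or_eq_rev_of_edge_eq h.symm with h | h
    · exact hinj k l hkl (congrArg H.tail h.symm)
    -- An edge traversed in both directions would have to be traversed consecutively, which is
    -- backtracking.
    · have h1 : l = k + 1 := hinj' (by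
        change H.tail (d l) = H.tail (d (k + 1))
        rw [h, tail_rev, hd])
      have h2 : d (k + 1) = (f (a (i + k))).1 := by
        rw [← ha]
        simp only [d, Fin.val_add_one_of_lt (hkl.trans_le (Fin.le_last l)), add_assoc]
      rw [h1, h2] at h
      exact hf _ h
  refine ⟨Finset.univ.image fun k => (d k).edge, ⟨n, d, hd, hinj', fun k l h => ?_, by simp⟩, ?_⟩
  · by_contra hkl
    rcases lt_or_gt_of_ne hkl with hkl | hkl
    exacts [hedge k l hkl h, hedge l k hkl h.symm]
  · intro e he
    simp only [Finset.coe_image, Finset.coe_univ, Set.image_univ, Set.mem_range] at he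
    obtain ⟨k, rfl⟩ := he
    exact (a (i + k)).2

/-- Only two darts of the cycle's edges start at this vertex: `d (j + 1)` and the reversal of `d j`.
They differ even when the cycle is a loop. -/
theorem dartSum_of_closed_walk {H : EmbeddedGraph E} {n : ℕ} {d : Fin (n + 1) → Dart E}
    (hd : ∀ i, H.head (d i) = H.tail (d (i + 1))) (hinj : Function.Injective fun i => H.tail (d i))
    {Z : Set E} (hZ : Z ⊆ Set.range fun i => (d i).edge)
    (hedge : Function.Injective fun i => (d i).edge) (j : Fin (n + 1)) :
    H.dartSum (fun x => Z.indicator 1 x.edge) (H.tail (d (j + 1))) =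
      Z.indicator 1 (d (j + 1)).edge + Z.indicator 1 (d j).edge := by
  classical
  have hne : d (j + 1) ≠ Dart.rev (d j) := by
    intro h
    have h1 : j + 1 = j := hedge (by simp only [h, Dart.edge_rev])
    rw [h1] at h
    exact Dart.rev_ne _ h.symm
  rw [dartSum, Fintype.sum_eq_add _ _ hne]
  · rw [if_pos rfl, if_pos ((H.tail_rev _).trans (hd j)), Dart.edge_rev]
  · rintro x ⟨hx1, hx2⟩
    split_ifs with hx
    · refine Set.indicator_of_notMem (fun hxZ => ?_) _
      obtain ⟨i, hi⟩ := hZ hxZ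
      rcases Dart.eq_or_eq_rev_of_edge_eq hi.symm with rfl | rfl
      · exact hx1 (congrArg d (hinj hx))
      · rw [tail_rev, hd] at hx
        exact hx2 (by rw [add_right_cancel (hinj hx)])
    · rfl

theorem IsCycle.isEven {H : EmbeddedGraph E} {C : Finset E} (hC : H.IsCycle C) :
    H.IsEven (C : Set E) := by
  classical
  obtain ⟨n, d, hd, hinj, hedge, hC⟩ := hC
  intro v
  by_cases hv : ∃ j, H.tail (d j) = v
  · obtain ⟨j, rfl⟩ := hv
    have h := dartSum_of_closed_walk hd hinj hC.subset hedge (j - 1)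
    rw [sub_add_cancel] at h
    have hmem : ∀ j, (d j).edge ∈ Set.range fun i => (d i).edge := fun j => ⟨j, rfl⟩
    rw [h, hC, Set.indicator_of_mem (hmem _), Set.indicator_of_mem (hmem _)]
    exact CharTwo.add_self_eq_zero _
  · refine Finset.sum_eq_zero fun x _ => ?_
    split_ifs with hx
    · refine Set.indicator_of_notMem (fun hxC => hv ?_) _
      rw [hC] at hxC
      obtain ⟨i, hi⟩ := hxC
      rcases Dart.eq_or_eq_rev_of_edge_eq hi.symm with rfl | rfl
      · exact ⟨i, hx⟩
      · exact ⟨i + 1, by rw [← hd, ← tail_rev, hx]⟩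
    · rfl

/-- Evenness at each vertex passes membership in `Z` from one edge of the cycle to the next. This
makes a cycle a minimal nonempty cut. -/
theorem IsCycle.eq_of_isEven_of_subset {H : EmbeddedGraph E} {C : Finset E} (hC : H.IsCycle C)
    {Z : Set E} (hZ : H.IsEven Z) (hZ0 : Z.Nonempty) (hZC : Z ⊆ C) : Z = C := by
  classical
  obtain ⟨n, d, hd, hinj, hedge, hC⟩ := hC
  rw [hC] at hZC ⊢
  have hstep : ∀ j, (d j).edge ∈ Z → (d (j + 1)).edge ∈ Z := by
    intro j hj
    have h := dartSum_of_closed_walk hd hinj hZC hedge j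
    rw [hZ, Set.indicator_of_mem hj] at h
    by_contra hj'
    rw [Set.indicator_of_notMem hj'] at h
    simp at h
  obtain ⟨e, he⟩ := hZ0
  obtain ⟨i, rfl⟩ := hZC he
  have hall : ∀ k, (d (i + k)).edge ∈ Z := by
    intro k
    induction k using Fin.induction with
    | zero => simpa using he
    | succ k ih =>
      rw [← Fin.coeSucc_eq_succ, ← add_assoc]
      exact hstep _ ih
  refine hZC.antisymm ?_
  rintro _ ⟨j, rfl⟩
  have h := hall (j - i)
  rw [add_sub_cancel] at h
  exact h

theorem IsCycle.exists_isFaceBond {H : EmbeddedGraph E} (hH : H.IsConnectedPlane) {C : Finset E}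
    (hC : H.IsCycle C) : ∃ S : Set H.Face, H.IsFaceBond S ∧ (C : Set E) = H.faceCut S := by
  obtain ⟨S, hS⟩ := hC.isEven.exists_faceCut_eq hH
  have hC0 : (C : Set E).Nonempty := by
    obtain ⟨n, d, -, -, -, hC⟩ := hC
    exact hC ▸ ⟨_, 0, rfl⟩
  refine ⟨S, isBond_of_minimal hH.1.cutConnected_univ (by rwa [← hS] at hC0) fun U hU0 hU => ?_,
    hS.symm⟩
  change H.faceCut U = H.faceCut S
  rw [hS]
  exact hC.eq_of_isEven_of_subset (H.isEven_faceCut U) hU0 (hS ▸ hU)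

/-- The cut is even, so it contains a cycle, itself the cut of a bond `U`; a bond whose cut lies in
that of the bond `S` is `S` or `Sᶜ`. -/
theorem IsFaceBond.exists_isCycle {H : EmbeddedGraph E} (hH : H.IsConnectedPlane) {S : Set H.Face}
    (hS : H.IsFaceBond S) : ∃ C : Finset E, H.IsCycle C ∧ (C : Set E) = H.faceCut S := by
  obtain ⟨C, hC, hCS⟩ := (H.isEven_faceCut S).exists_isCycle_subset
    (hH.1.cutConnected_univ.edgeCut_nonempty hS.nonempty hS.compl_nonempty)
  obtain ⟨U, hU, hCU⟩ := hC.exists_isFaceBond hH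
  refine ⟨C, hC, hCU.trans ?_⟩
  rcases hS.eq_or_eq_compl (hCU ▸ hCS) with h | h | h | h
  · exact absurd h hU.nonempty.ne_empty
  · exact absurd (Set.compl_empty_iff.2 h) hU.compl_nonempty.ne_empty
  · rw [h]
  · rw [h]
    exact edgeCut_compl S

theorem sum_eq_cutWeight {H : EmbeddedGraph E} (w : E → ℝ≥0∞) {C : Finset E} {S : Set H.Face}
    (hC : (C : Set E) = H.faceCut S) :
    ∑ e ∈ C, w e =
      cutWeight (fun e => H.leftFace (e, 1)) (fun e => H.rightFace (e, 1)) w S := by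
  classical
  unfold faceCut at hC
  rw [cutWeight, ← hC, Finset.sum_indicator_subset w (Finset.subset_univ C)]

end Even

/-! ### Separation and crossing in terms of bonds. -/

theorem faceSeparating_iff {H : EmbeddedGraph E} {S : Set H.Face} (hS : H.IsFaceBond S)
    {C : Finset E} (hC : (C : Set E) = H.faceCut S) (o f g : H.Face) :
    H.FaceSeparating o f g C ↔ ¬ (f ∈ S ↔ g ∈ S) := by
  rw [FaceSeparating, xor_def, encloses_iff hS hC, encloses_iff hS hC]
  tauto

theorem setSeparating_iff {H : EmbeddedGraph E} {S : Set H.Face} (hS : H.IsFaceBond S)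
    {C : Finset E} (hC : (C : Set E) = H.faceCut S) (o : H.Face) (X : Set H.Face) :
    H.SetSeparating o X C ↔ (∃ x ∈ X, x ∈ S) ∧ ∃ y ∈ X, y ∉ S := by
  simp only [SetSeparating, encloses_iff hS hC]
  by_cases ho : o ∈ S
  · simp only [ho, iff_true, not_not]
    exact and_comm
  · simp only [ho, iff_false, not_not]

/-- Every edge of `D` borders a face of `Q`, and the faces of `Q` are all enclosed by `C` or all not
enclosed. -/
theorem not_crosses {H : EmbeddedGraph E} {S : Set H.Face} (hS : H.IsFaceBond S)
    {C : Finset E} (hC : (C : Set E) = H.faceCut S)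
    {Q : Set H.Face} {D : Finset E} (hD : (D : Set E) = H.faceCut Q)
    (hQ : Q ⊆ Sᶜ ∨ Q ⊆ S) (o : H.Face) : ¬ H.Crosses o D C := by
  have key : ∀ e ∈ D, ∃ d : Dart E, d.edge = e ∧ H.leftFace d ∈ Q := by
    intro e he
    rw [← Finset.mem_coe, hD, mem_edgeCut] at he
    by_cases h : H.leftFace (e, 1) ∈ Q
    · exact ⟨(e, 1), rfl, h⟩
    · exact ⟨Dart.rev (e, 1), rfl, by rw [leftFace_rev]; tauto⟩
  rintro ⟨h1, h2⟩
  by_cases h : ∀ f ∈ Q, ¬ (f ∈ S ↔ o ∈ S)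
  · refine h1 fun e he => ?_
    obtain ⟨d, hd, hdQ⟩ := key e he
    exact ⟨d, hd, (encloses_iff hS hC o _).2 (h _ hdQ)⟩
  · refine h2 fun e he => ?_
    obtain ⟨d, hd, hdQ⟩ := key e he
    refine ⟨d, hd, fun henc => h fun f hf => ?_⟩
    have h3 := (encloses_iff hS hC o _).1 henc
    rcases hQ with hQ | hQ
    · have := hQ hf
      have := hQ hdQ
      rw [Set.mem_compl_iff] at *
      tauto
    · have := hQ hf
      have := hQ hdQ
      tauto

theorem exists_isShortestCycle [Fintype E] {H : EmbeddedGraph E} (w : E → ℝ≥0∞)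
    {P : Finset E → Prop} (h : ∃ C, H.IsCycle C ∧ P C) : ∃ C, H.IsShortestCycle w P C := by
  obtain ⟨C, hC, hmin⟩ := Set.exists_min_image {C : Finset E | H.IsCycle C ∧ P C}
    (fun C => ∑ e ∈ C, w e) (Set.toFinite _) h
  exact ⟨C, hC.1, hC.2, fun C' h1 h2 => hmin C' ⟨h1, h2⟩⟩

end EmbeddedGraph

/-- The shortest separating cycle that also separates terminals can be chosen not to cross `C`. -/
theorem mainTheorem5 {E : Type*} [Finite E] (G : EmbeddedGraph E) (hG : G.IsConnectedPlane)
    (w : E → ℝ≥0∞) (o : G.dual.Face) (X : Set G.Vertex) (ve v : G.Vertex)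
    (hex : ∃ C' : Finset E, G.dual.IsCycle C' ∧
      G.dual.FaceSeparating o (G.vertexFace ve) (G.vertexFace v) C' ∧
      G.dual.SetSeparating o (G.vertexFace '' X) C')
    (C : Finset E)
    (hC : G.dual.IsShortestCycle w
      (G.dual.FaceSeparating o (G.vertexFace ve) (G.vertexFace v)) C)
    (hCX : ¬ G.dual.SetSeparating o (G.vertexFace '' X) C) :
    ∃ C' : Finset E,
      G.dual.IsShortestCycle w
        (fun D => G.dual.FaceSeparating o (G.vertexFace ve) (G.vertexFace v) D ∧
          G.dual.SetSeparating o (G.vertexFace '' X) D) C' ∧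
      ¬ G.dual.Crosses o C' C := by
  have := Fintype.ofFinite E
  have hH := hG.dual
  obtain ⟨B, hB, ⟨hBst, hBX⟩, hBmin⟩ := EmbeddedGraph.exists_isShortestCycle w hex
  obtain ⟨hC, hCst, hCmin⟩ := hC
  obtain ⟨S, hS, hCS⟩ := hC.exists_isFaceBond hH
  obtain ⟨R, hR, hBR⟩ := hB.exists_isFaceBond hH
  rw [EmbeddedGraph.faceSeparating_iff hS hCS] at hCst
  rw [EmbeddedGraph.faceSeparating_iff hR hBR] at hBst
  rw [EmbeddedGraph.setSeparating_iff hS hCS] at hCX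
  rw [EmbeddedGraph.setSeparating_iff hR hBR] at hBX
  obtain ⟨Q, hQ, hQst, hQS, hQX, hQX', hQw⟩ := exists_isBond_not_crossing
    hH.1.cutConnected_univ w hS hR (fun U hU hst => by
      obtain ⟨D, hD, hDU⟩ := EmbeddedGraph.IsFaceBond.exists_isCycle hH hU
      rw [← EmbeddedGraph.sum_eq_cutWeight w hCS, ← EmbeddedGraph.sum_eq_cutWeight w hDU]
      exact hCmin D hD ((EmbeddedGraph.faceSeparating_iff hU hDU _ _ _).2 hst))
    hCst hBst hCX hBX
  obtain ⟨D, hD, hDQ⟩ := EmbeddedGraph.IsFaceBond.exists_isCycle hH hQ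
  rw [← EmbeddedGraph.sum_eq_cutWeight w hDQ, ← EmbeddedGraph.sum_eq_cutWeight w hBR] at hQw
  exact ⟨D, ⟨hD, ⟨(EmbeddedGraph.faceSeparating_iff hQ hDQ _ _ _).2 hQst,
    (EmbeddedGraph.setSeparating_iff hQ hDQ _ _).2 ⟨hQX, hQX'⟩⟩,
    fun C' h1 h2 => hQw.trans (hBmin C' h1 h2)⟩,
    EmbeddedGraph.not_crosses hS hCS hDQ hQS o⟩
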